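/- For integers $\ell\ge 1$ and $n\ge 1$ let $\mathrm{pod}_\ell(n)$ be the number of partitions of $n$ in which no part is divisible by $\ell$ and the odd parts are distinct (even parts are unrestricted otherwise). Let $\sigma_1(m)=\sum_{d\mid m} d$ and $\sigma_{2,\chi}(m)=\sum_{d\mid m}\chi(d)\,d^2$, where $d$ runs over the positive divisors of $m$ and $\chi$ is the Dirichlet character modulo $4$ with $\chi(1)=1$ and $\chi(3)=-1$. Then for every positive integer $n$, $$\mathrm{pod}_5(n)\equiv(-1)^n\,\sigma_1(2n+1)\pmod 5,$$ and $\tfrac18\,\sigma_{2,\chi}(4n+3)$ is an integer with $$\mathrm{pod}_7(n)\equiv(-1)^{n+1}\,\tfrac18\,\sigma_{2,\chi}(4n+3)\pmod 7.$$ -/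

import Mathlib

/-- The set of `ℓ`-regular partitions of `n` with distinct odd parts: no part is divisible by `ℓ`,
every odd part occurs at most once, and even parts may be repeated. -/
def podPartitions (ℓ n : ℕ) : Finset (Nat.Partition n) :=
  Finset.univ.filter fun P =>
    (∀ i ∈ P.parts, ¬ ℓ ∣ i) ∧ ∀ i ∈ P.parts, Odd i → P.parts.count i = 1

/-- `pod ℓ n` is the number of `ℓ`-regular partitions of `n` with distinct odd parts. -/
def pod (ℓ n : ℕ) : ℕ := (podPartitions ℓ n).card

/-- The divisor function twisted by a Dirichlet character:
`sigmaChar k χ m` is the sum of `χ d * d ^ k` over the positive divisors `d` of `m`. -/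
def sigmaChar {N : ℕ} (k : ℕ) (χ : DirichletCharacter ℤ N) (m : ℕ) : ℤ :=
  ∑ d ∈ m.divisors, χ (d : ZMod N) * (d : ℤ) ^ k

/-! Let `P = podSeries 0`; as no positive part is divisible by 0, this is the generating function of
all partitions with distinct odd parts, the product of (1 + q^i) over odd i and 1/(1 - q^i) over
even i. Thus P(q) = 1/ψ(-q), with ψ(q) the sum of q^(m(m+1)/2) over m ≥ 0. Modulo an odd prime p,
Frobenius turns the factors at multiples of p into P^p, so the p-regular series is P/P^p =
ψ(-q)^(p-1) (`podSeries_mul_pow`). Hence p = 5 and p = 7 need the fourth and sixth powers of ψ: the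
coefficients of ψ(q)^4 are σ₁(2n+1), and those of ψ(q)^6 are -σ_{2,χ}(4n+3)/8. Neither theta
functions nor modular forms enter. Logarithmic differentiation shows that c(n), the coefficients of
ψ^k, are determined by c(0) and n c(n) = k ∑ `altSigma` j · c(n-j). The divisor sums satisfy the
same recurrence (`sigma_recurrence`, `sigmaChar_recurrence`), by Liouville's elementary method: the
convolution becomes a sum over positive solutions of ax + by = N, evaluated through `liouville_odd`
and `liouville_even`. The resulting identities hold over ℤ, so the divisibility by 8 comes with
them. -/

open Finset

/-! ### Sums over positive solutions of ax + by = N. -/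

/-- The quadruples `(a, b, x, y)` of positive integers with `a * x + b * y = N`. -/
def quads (N : ℕ) : Finset (ℕ × ℕ × ℕ × ℕ) :=
  (Icc 1 N ×ˢ Icc 1 N ×ˢ Icc 1 N ×ˢ Icc 1 N).filter
    fun q => q.1 * q.2.2.1 + q.2.1 * q.2.2.2 = N

theorem mem_quads {N a b x y : ℕ} :
    (a, b, x, y) ∈ quads N ↔ 0 < a ∧ 0 < b ∧ 0 < x ∧ 0 < y ∧ a * x + b * y = N := by
  simp only [quads, mem_filter, mem_product, mem_Icc]
  constructor
  · rintro ⟨⟨h1, h2, h3, h4⟩, h⟩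
    exact ⟨h1.1, h2.1, h3.1, h4.1, h⟩
  · rintro ⟨h1, h2, h3, h4, h⟩
    refine ⟨⟨⟨h1, ?_⟩, ⟨h2, ?_⟩, ⟨h3, ?_⟩, ⟨h4, ?_⟩⟩, h⟩ <;> nlinarith

/-- The sum of `g a b x y` over the positive solutions of `a * x + b * y = N`. -/
def quadSum (N : ℕ) (g : ℕ → ℕ → ℕ → ℕ → ℤ) : ℤ :=
  ∑ q ∈ quads N, g q.1 q.2.1 q.2.2.1 q.2.2.2

theorem quadSum_congr {N : ℕ} {g h : ℕ → ℕ → ℕ → ℕ → ℤ}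
    (H : ∀ a b x y, 0 < a → 0 < b → 0 < x → 0 < y → a * x + b * y = N → g a b x y = h a b x y) :
    quadSum N g = quadSum N h := by
  refine sum_congr rfl ?_
  rintro ⟨a, b, x, y⟩ hq
  obtain ⟨h1, h2, h3, h4, h5⟩ := mem_quads.1 hq
  exact H a b x y h1 h2 h3 h4 h5

theorem quadSum_add (N : ℕ) (g h : ℕ → ℕ → ℕ → ℕ → ℤ) :
    quadSum N (fun a b x y => g a b x y + h a b x y) = quadSum N g + quadSum N h :=
  sum_add_distrib

theorem quadSum_sub (N : ℕ) (g h : ℕ → ℕ → ℕ → ℕ → ℤ) :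
    quadSum N (fun a b x y => g a b x y - h a b x y) = quadSum N g - quadSum N h :=
  sum_sub_distrib ..

theorem quadSum_mul (N : ℕ) (c : ℤ) (g : ℕ → ℕ → ℕ → ℕ → ℤ) :
    quadSum N (fun a b x y => c * g a b x y) = c * quadSum N g :=
  (mul_sum ..).symm

/-- Interchanging the two products. -/
theorem quadSum_swap (N : ℕ) (g : ℕ → ℕ → ℕ → ℕ → ℤ) :
    quadSum N g = quadSum N fun a b x y => g b a y x := by
  refine sum_nbij' (fun q => (q.2.1, q.1, q.2.2.2, q.2.2.1))
    (fun q => (q.2.1, q.1, q.2.2.2, q.2.2.1)) ?_ ?_ ?_ ?_ ?_ <;>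
  rintro ⟨a, b, x, y⟩ <;> simp only [mem_quads, implies_true] <;> grind

/-- Interchanging the factors of the first product. -/
theorem quadSum_swap_left (N : ℕ) (g : ℕ → ℕ → ℕ → ℕ → ℤ) :
    quadSum N g = quadSum N fun a b x y => g x b a y := by
  refine sum_nbij' (fun q => (q.2.2.1, q.2.1, q.1, q.2.2.2))
    (fun q => (q.2.2.1, q.2.1, q.1, q.2.2.2)) ?_ ?_ ?_ ?_ ?_ <;>
  rintro ⟨a, b, x, y⟩ <;> simp only [mem_quads, implies_true] <;> grind

/-- The substitution comes from ax + by = a(x - y) + (a + b)y, which is a bijection from solutions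
with y < x to solutions with a < b. -/
theorem quadSum_shift_lt (N : ℕ) (g : ℕ → ℕ → ℕ → ℕ → ℤ) :
    quadSum N (fun a b x y => if y < x then g a b x y else 0) =
      quadSum N fun a b x y => if a < b then g a (b - a) (x + y) y else 0 := by
  unfold quadSum
  rw [← sum_filter, ← sum_filter]
  refine sum_nbij' (fun q => (q.1, q.1 + q.2.1, q.2.2.1 - q.2.2.2, q.2.2.2))
    (fun q => (q.1, q.2.1 - q.1, q.2.2.1 + q.2.2.2, q.2.2.2)) ?_ ?_ ?_ ?_ ?_
  · rintro ⟨a, b, x, y⟩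
    simp only [mem_filter, mem_quads]
    rintro ⟨⟨h1, h2, h3, h4, h5⟩, h⟩
    obtain ⟨t, rfl⟩ := Nat.exists_eq_add_of_lt h
    refine ⟨⟨h1, by omega, by omega, h4, ?_⟩, by omega⟩
    rw [show y + t + 1 - y = t + 1 by omega, ← h5]; ring
  · rintro ⟨a, b, x, y⟩
    simp only [mem_filter, mem_quads]
    rintro ⟨⟨h1, h2, h3, h4, h5⟩, h⟩
    obtain ⟨t, rfl⟩ := Nat.exists_eq_add_of_lt h
    refine ⟨⟨h1, by omega, by omega, h4, ?_⟩, by omega⟩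
    rw [show a + t + 1 - a = t + 1 by omega, ← h5]; ring
  · rintro ⟨a, b, x, y⟩
    simp only [mem_filter, mem_quads, Prod.mk.injEq]
    rintro ⟨-, h⟩
    exact ⟨trivial, by omega, by omega, trivial⟩
  · rintro ⟨a, b, x, y⟩
    simp only [mem_filter, mem_quads, Prod.mk.injEq]
    rintro ⟨-, h⟩
    exact ⟨trivial, by omega, by omega, trivial⟩
  · rintro ⟨a, b, x, y⟩
    simp only [mem_filter, mem_quads]
    rintro ⟨-, h⟩
    rw [Nat.add_sub_cancel_left, Nat.sub_add_cancel h.le]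

/-- The previous bijection and its mirror image together cover all solutions with x ≠ y. The
unmatched solutions, x = y on one side and a = b on the other, produce the divisor sums in
Liouville's identities. -/
theorem quadSum_shift (N : ℕ) (g : ℕ → ℕ → ℕ → ℕ → ℤ) :
    quadSum N (fun a b x y => if x = y then 0 else g a b x y) =
      quadSum N fun a b x y => (if a < b then g a (b - a) (x + y) y else 0) +
        if b < a then g (a - b) b x (x + y) else 0 := by
  have h1 := quadSum_shift_lt N g
  have h2 := quadSum_shift_lt N fun a b x y => g b a y x
  rw [quadSum_swap, quadSum_swap N fun a b x y => if a < b then _ else _] at h2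
  rw [quadSum_add, ← h1]
  simp only [add_comm] at h2 ⊢
  rw [← h2, ← quadSum_add]
  refine quadSum_congr fun a b x y _ _ _ _ _ => ?_
  rcases lt_trichotomy x y with h | h | h
  · simp [h, h.ne, h.le]
  · simp [h]
  · simp [h, h.ne', h.le]

/-- For odd `N` exactly one of the two products is odd; it may be taken to be the first. -/
theorem quadSum_of_odd {N : ℕ} (hN : N % 2 = 1) (g : ℕ → ℕ → ℕ → ℕ → ℤ) :
    quadSum N g = quadSum N fun a b x y =>
      if a % 2 = 1 ∧ x % 2 = 1 then g a b x y + g b a y x else 0 := by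
  have e1 : quadSum N g = quadSum N (fun a b x y => if a % 2 = 1 ∧ x % 2 = 1 then g a b x y else 0)
      + quadSum N (fun a b x y => if b % 2 = 1 ∧ y % 2 = 1 then g a b x y else 0) := by
    rw [← quadSum_add]
    refine quadSum_congr fun a b x y _ _ _ _ h => ?_
    have h' : (a * x + b * y) % 2 = 1 := by rw [h, hN]
    rw [Nat.add_mod, Nat.mul_mod, Nat.mul_mod b] at h'
    rcases Nat.mod_two_eq_zero_or_one a with ha | ha <;>
    rcases Nat.mod_two_eq_zero_or_one b with hb | hb <;>
    rcases Nat.mod_two_eq_zero_or_one x with hx | hx <;>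
    rcases Nat.mod_two_eq_zero_or_one y with hy | hy <;>
    simp [ha, hb, hx, hy] at h' ⊢
  rw [e1, quadSum_swap N fun a b x y => if b % 2 = 1 ∧ y % 2 = 1 then _ else _, ← quadSum_add]
  refine quadSum_congr fun a b x y _ _ _ _ _ => ?_
  split_ifs <;> simp

theorem odd_or_even_of_quad {N a b x y : ℕ} (hN : N % 2 = 1) (h : a * x + b * y = N)
    (ha : a % 2 = 1) (hx : x % 2 = 1) : b % 2 = 0 ∨ y % 2 = 0 := by
  have h' : (a * x + b * y) % 2 = 1 := by rw [h, hN]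
  rw [Nat.add_mod, Nat.mul_mod, Nat.mul_mod b] at h'
  rcases Nat.mod_two_eq_zero_or_one b with hb | hb <;>
  rcases Nat.mod_two_eq_zero_or_one y with hy | hy <;>
  simp [ha, hb, hx, hy] at h' ⊢

theorem odd_of_quad_even {N a b x y : ℕ} (hN : N % 2 = 1) (h : a * x + b * y = N)
    (hb : b % 2 = 0) : a % 2 = 1 ∧ x % 2 = 1 := by
  have h' : (a * x + b * y) % 2 = 1 := by rw [h, hN]
  rw [Nat.add_mod, Nat.mul_mod, Nat.mul_mod b] at h'
  rcases Nat.mod_two_eq_zero_or_one a with ha | ha <;>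
  rcases Nat.mod_two_eq_zero_or_one x with hx | hx <;>
  simp [ha, hb, hx] at h' ⊢

/-! ### Liouville's identities for odd N. -/

theorem liouville_odd {N : ℕ} (hN : N % 2 = 1) (F : ℤ → ℤ) (hF : ∀ z, F (-z) = F z) :
    quadSum N (fun a b _ y => if b % 2 = 0 ∧ y % 2 = 1 then F (a + b) - F (a - b) else 0) =
      quadSum N (fun a b x y => if x = y ∧ b % 2 = 0 then F (a + b) else 0) -
      quadSum N (fun a b x y => if a = b ∧ x % 2 = 1 ∧ y % 2 = 0 then F a else 0) := by
  -- This test function makes the terms with y even cancel, except at a = b. Those with b even and y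
  -- odd leave F(a + b) - F(a - b), with x = y as boundary.
  have key := quadSum_shift N fun a b x y => if a % 2 = 1 ∧ x % 2 = 1 then
    (if y % 2 = 0 then F a else F (a + b)) else 0
  rw [← sub_eq_zero, ← quadSum_sub, quadSum_of_odd hN] at key
  rw [← quadSum_sub, ← sub_eq_zero, ← quadSum_sub]
  refine (quadSum_congr fun a b x y _ _ _ _ h => ?_).trans key
  have e1 := odd_or_even_of_quad hN h
  have e2 := odd_of_quad_even hN h
  have e3 : F (b - a) = F (a - b) := by rw [← hF]; congr 1; ring
  by_cases hax : a % 2 = 1 ∧ x % 2 = 1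
  · specialize e1 hax.1 hax.2
    rcases lt_trichotomy a b with hab | hab | hab <;>
    rcases e1 with hb | hy <;> grind
  · have hb : b % 2 ≠ 0 := fun hb => hax (e2 hb)
    have hab : ¬ (a = b ∧ x % 2 = 1 ∧ y % 2 = 0) := by
      rintro ⟨rfl, hx, -⟩
      exact hax ⟨by omega, hx⟩
    simp [hax, hb, hab]

theorem liouville_even {N : ℕ} (hN : N % 2 = 1) (F : ℤ → ℤ) (hF : ∀ z, F (-z) = F z) :
    quadSum N (fun a b _ y => if b % 2 = 0 ∧ y % 2 = 0 then F (a + b) - F (a - b) else 0) =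
      quadSum N (fun a b x y => if x = y ∧ b % 2 = 0 then F a else 0) -
      quadSum N (fun a b x y => if a = b ∧ x % 2 = 1 ∧ y % 2 = 0 then F a else 0) := by
  -- Here the terms with b odd cancel (F b against F b), as do those with b even and y odd (F a
  -- against F a), apart from the boundaries a = b and x = y; b and y both even leaves F(a + b) -
  -- F(a - b).
  have key := quadSum_shift N fun a b x y => if a % 2 = 1 ∧ x % 2 = 1 then
    (if b % 2 = 1 then F b else if y % 2 = 0 then F (a + b) else F a) else 0
  rw [← sub_eq_zero, ← quadSum_sub, quadSum_of_odd hN] at key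
  rw [← quadSum_sub, ← sub_eq_zero, ← quadSum_sub]
  refine (quadSum_congr fun a b x y _ _ _ _ h => ?_).trans key
  have e1 := odd_or_even_of_quad hN h
  have e2 := odd_of_quad_even hN h
  have e3 : F (b - a) = F (a - b) := by rw [← hF]; congr 1; ring
  by_cases hax : a % 2 = 1 ∧ x % 2 = 1
  · specialize e1 hax.1 hax.2
    rcases lt_trichotomy a b with hab | hab | hab <;>
    rcases e1 with hb | hy <;> grind
  · have hb : b % 2 ≠ 0 := fun hb => hax (e2 hb)
    have hab : ¬ (a = b ∧ x % 2 = 1 ∧ y % 2 = 0) := by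
      rintro ⟨rfl, hx, -⟩
      exact hax ⟨by omega, hx⟩
    simp [hax, hb, hab]

/-! ### Boundary terms as divisor sums, and convolutions as quadruple sums. -/

/-- Interchanging the factors of both products. -/
theorem quadSum_transpose (N : ℕ) (g : ℕ → ℕ → ℕ → ℕ → ℤ) :
    quadSum N g = quadSum N fun a b x y => g x y a b := by
  refine sum_nbij' (fun q => (q.2.2.1, q.2.2.2, q.1, q.2.1))
    (fun q => (q.2.2.1, q.2.2.2, q.1, q.2.1)) ?_ ?_ ?_ ?_ ?_ <;>
  rintro ⟨a, b, x, y⟩ <;> simp only [mem_quads, implies_true] <;> grind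

theorem quadSum_diag (N : ℕ) (G : ℕ → ℕ → ℕ → ℤ) :
    quadSum N (fun a b x y => if a = b then G a x y else 0) =
      ∑ p ∈ N.divisorsAntidiagonal, ∑ x ∈ Ico 1 p.2, G p.1 x (p.2 - x) := by
  unfold quadSum
  rw [← sum_filter, sum_sigma']
  refine sum_nbij' (fun q => ⟨(q.1, q.2.2.1 + q.2.2.2), q.2.2.1⟩)
    (fun s => (s.1.1, s.1.1, s.2, s.1.2 - s.2)) ?_ ?_ ?_ ?_ ?_
  · rintro ⟨a, b, x, y⟩
    simp only [mem_filter, mem_quads, mem_sigma, Nat.mem_divisorsAntidiagonal, mem_Ico]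
    rintro ⟨⟨h1, h2, h3, h4, h5⟩, rfl⟩
    refine ⟨⟨by rw [← h5]; ring, ?_⟩, by omega, by omega⟩
    rintro rfl
    have := Nat.mul_pos h1 h3
    omega
  · rintro ⟨⟨a, z⟩, x⟩
    simp only [mem_filter, mem_quads, mem_sigma, Nat.mem_divisorsAntidiagonal, mem_Ico]
    rintro ⟨⟨h, h0⟩, h1, h2⟩
    have ha : 0 < a := Nat.pos_of_ne_zero (by rintro rfl; simp at h; exact h0 h.symm)
    refine ⟨⟨ha, ha, h1, by omega, ?_⟩, trivial⟩
    rw [← mul_add, Nat.add_sub_cancel' h2.le, h]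
  · rintro ⟨a, b, x, y⟩
    simp only [mem_filter, mem_quads, Prod.mk.injEq]
    rintro ⟨-, h⟩
    exact ⟨trivial, h, trivial, by omega⟩
  · rintro ⟨⟨a, z⟩, x⟩
    simp only [mem_sigma, mem_Ico]
    rintro ⟨-, h1, h2⟩
    rw [Nat.add_sub_cancel' h2.le]
  · rintro ⟨a, b, x, y⟩
    simp

theorem odd_of_mul_eq {N a z : ℕ} (hN : N % 2 = 1) (h : a * z = N) : z % 2 = 1 :=
  Nat.odd_iff.1 (Nat.Odd.of_mul_right (Nat.odd_iff.2 (h ▸ hN)))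

theorem sum_divisorsAntidiagonal_comm (N : ℕ) (f : ℕ × ℕ → ℤ) :
    ∑ p ∈ N.divisorsAntidiagonal, f p = ∑ p ∈ N.divisorsAntidiagonal, f p.swap := by
  rw [← Nat.map_swap_divisorsAntidiagonal, sum_map, Nat.map_swap_divisorsAntidiagonal]
  rfl

theorem sum_Ico_odd_const {z : ℕ} (hz : z % 2 = 1) (c : ℤ) :
    2 * ∑ x ∈ Ico 1 z, (if x % 2 = 1 then c else 0) = c * (z - 1) := by
  obtain ⟨k, rfl⟩ : ∃ k, z = 2 * k + 1 := ⟨z / 2, by omega⟩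
  induction k with
  | zero => simp
  | succ k ih =>
    rw [show 2 * (k + 1) + 1 = 2 * k + 1 + 1 + 1 by ring, sum_Ico_succ_top (by omega),
      sum_Ico_succ_top (by omega), mul_add, mul_add, ih (by omega), if_pos (by omega),
      if_neg (by omega)]
    push_cast; ring

theorem quadSum_diag_even {N : ℕ} (hN : N % 2 = 1) (F : ℤ → ℤ) :
    2 * quadSum N (fun a b x y => if a = b ∧ x % 2 = 1 ∧ y % 2 = 0 then F a else 0) =
      ∑ p ∈ N.divisorsAntidiagonal, F p.1 * (p.2 - 1) := by
  have := quadSum_diag N fun a x y => if x % 2 = 1 ∧ y % 2 = 0 then F a else 0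
  simp only [← ite_and] at this
  rw [this, mul_sum]
  refine sum_congr rfl fun p hp => ?_
  have hz := odd_of_mul_eq hN (Nat.mem_divisorsAntidiagonal.1 hp).1
  rw [← sum_Ico_odd_const hz]
  congr 1
  refine sum_congr rfl fun x hx => if_congr ?_ rfl rfl
  rw [mem_Ico] at hx
  omega

theorem quadSum_codiag {N : ℕ} (hN : N % 2 = 1) (F : ℕ → ℕ → ℤ) :
    quadSum N (fun a b x y => if x = y ∧ b % 2 = 0 then F a b else 0) =
      ∑ p ∈ N.divisorsAntidiagonal, ∑ x ∈ Ico 1 p.1,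
        if x % 2 = 1 then F x (p.1 - x) else 0 := by
  have := quadSum_diag N fun a x y => if y % 2 = 0 then F x y else 0
  simp only [← ite_and] at this
  rw [quadSum_transpose, this, sum_divisorsAntidiagonal_comm]
  refine sum_congr rfl fun p hp => ?_
  have hz := odd_of_mul_eq hN ((mul_comm _ _).trans (Nat.mem_divisorsAntidiagonal.1 hp).1)
  refine sum_congr rfl fun x hx => if_congr ?_ rfl rfl
  simp only [mem_Ico, Prod.snd_swap] at hx ⊢
  omega

/-- Writing b = ud and y = vw splits kn + r = ax + by as ax = km + r and by = k(dw), with m + dw =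
n. -/
theorem quadSum_eq_convolution {k r u v : ℕ} (n : ℕ) (hu : 0 < u) (hv : 0 < v) (huv : u * v = k)
    (hr : 0 < r) (hrk : r < k) (f h : ℕ → ℤ) :
    quadSum (k * n + r) (fun a b _ y => if u ∣ b ∧ v ∣ y then f a * h (b / u) else 0) =
      ∑ s ∈ antidiagonal n, (∑ p ∈ s.1.divisorsAntidiagonal, h p.1) *
        ∑ p ∈ (k * s.2 + r).divisorsAntidiagonal, f p.1 := by
  unfold quadSum
  simp_rw [sum_mul_sum, ← sum_product']
  rw [← sum_filter, sum_sigma']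
  refine sum_nbij' (fun q => ⟨((q.2.1 / u) * (q.2.2.2 / v), (q.1 * q.2.2.1 - r) / k),
      ((q.2.1 / u, q.2.2.2 / v), (q.1, q.2.2.1))⟩)
    (fun s => (s.2.2.1, u * s.2.1.1, s.2.2.2, v * s.2.1.2)) ?_ ?_ ?_ ?_ ?_
  · rintro ⟨a, b, x, y⟩
    simp only [mem_filter, mem_quads, mem_sigma, mem_product, Nat.mem_divisorsAntidiagonal,
      HasAntidiagonal.mem_antidiagonal]
    rintro ⟨⟨h1, h2, h3, h4, h5⟩, ⟨d, rfl⟩, ⟨w, rfl⟩⟩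
    rw [Nat.mul_div_cancel_left _ hu, Nat.mul_div_cancel_left _ hv]
    have e : a * x + k * (d * w) = k * n + r := by rw [← h5, ← huv]; ring
    have hmod : a * x % k = r := by
      have := congrArg (· % k) e
      simpa [Nat.mul_add_mod, Nat.mod_eq_of_lt hrk] using this
    have hax := Nat.div_add_mod (a * x) k
    rw [hmod] at hax
    have e2 : (a * x - r) / k = a * x / k := by
      rw [← hax, Nat.add_sub_cancel, Nat.mul_div_cancel_left _ (hr.trans hrk),
        Nat.mul_add_div (hr.trans hrk), Nat.div_eq_of_lt hrk, add_zero]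
    rw [e2]
    have hd : 0 < d := Nat.pos_of_ne_zero (by rintro rfl; simp at h2)
    have hw : 0 < w := Nat.pos_of_ne_zero (by rintro rfl; simp at h4)
    refine ⟨?_, ⟨trivial, (Nat.mul_pos hd hw).ne'⟩, hax.symm, by omega⟩
    have : k * (d * w + a * x / k) = k * n := by rw [mul_add]; omega
    exact Nat.eq_of_mul_eq_mul_left (hr.trans hrk) this
  · rintro ⟨⟨j, m⟩, ⟨d, w⟩, ⟨a, x⟩⟩
    simp only [mem_filter, mem_quads, mem_sigma, mem_product, Nat.mem_divisorsAntidiagonal,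
      HasAntidiagonal.mem_antidiagonal]
    rintro ⟨rfl, ⟨rfl, h1⟩, h2, h3⟩
    have hax : 0 < a * x := by omega
    refine ⟨⟨Nat.pos_of_mul_pos_right hax, Nat.mul_pos hu ?_, Nat.pos_of_mul_pos_left hax,
      Nat.mul_pos hv ?_, ?_⟩, dvd_mul_right _ _, dvd_mul_right _ _⟩
    · exact Nat.pos_of_ne_zero (left_ne_zero_of_mul h1)
    · exact Nat.pos_of_ne_zero (right_ne_zero_of_mul h1)
    · rw [h2, ← huv]; ring
  · rintro ⟨a, b, x, y⟩
    simp only [mem_filter, Prod.mk.injEq]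
    rintro ⟨-, hb, hy⟩
    exact ⟨trivial, Nat.mul_div_cancel' hb, trivial, Nat.mul_div_cancel' hy⟩
  · rintro ⟨⟨j, m⟩, ⟨d, w⟩, ⟨a, x⟩⟩
    simp only [mem_sigma, mem_product, Nat.mem_divisorsAntidiagonal, HasAntidiagonal.mem_antidiagonal]
    rintro ⟨rfl, ⟨rfl, h1⟩, h2, h3⟩
    rw [Nat.mul_div_cancel_left _ hu, Nat.mul_div_cancel_left _ hv, h2, Nat.add_sub_cancel,
      Nat.mul_div_cancel_left _ (hr.trans hrk)]
  · rintro ⟨a, b, x, y⟩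
    simp [mul_comm]

/-! ### The recurrence for σ₁(2n+1). -/

theorem quadSum_mul_even_odd {N : ℕ} (hN : N % 2 = 1) :
    8 * quadSum N (fun a b _ y => if b % 2 = 0 ∧ y % 2 = 1 then (a * b : ℤ) else 0) =
      ∑ p ∈ N.divisorsAntidiagonal, ((p.1 : ℤ) ^ 3 - N * p.1) := by
  -- With F(z) = z², the difference F(a + b) - F(a - b) is 4ab.
  have h := liouville_odd hN (fun z => z ^ 2) (fun z => by ring)
  have h1 := quadSum_diag_even hN (fun z => z ^ 2)
  have h2 := quadSum_codiag hN (fun a b => ((a : ℤ) + b) ^ 2)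
  have h3 : 2 * quadSum N (fun a b x y => if x = y ∧ b % 2 = 0 then ((a : ℤ) + b) ^ 2 else 0) =
      ∑ p ∈ N.divisorsAntidiagonal, (p.1 : ℤ) ^ 2 * (p.1 - 1) := by
    rw [h2, mul_sum]
    refine sum_congr rfl fun p hp => ?_
    have hz := odd_of_mul_eq hN ((mul_comm _ _).trans (Nat.mem_divisorsAntidiagonal.1 hp).1)
    rw [← sum_Ico_odd_const hz]
    congr 1
    refine sum_congr rfl fun x hx => ?_
    rw [mem_Ico] at hx
    rw [Nat.cast_sub hx.2.le, add_sub_cancel]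
  have h4 : quadSum N (fun a b _ y => if b % 2 = 0 ∧ y % 2 = 1 then
      ((a : ℤ) + b) ^ 2 - (a - b) ^ 2 else 0) =
      4 * quadSum N (fun a b _ y => if b % 2 = 0 ∧ y % 2 = 1 then (a * b : ℤ) else 0) := by
    rw [← quadSum_mul]
    refine quadSum_congr fun a b x y _ _ _ _ _ => ?_
    split_ifs <;> ring
  have h5 : ∑ p ∈ N.divisorsAntidiagonal, ((p.1 : ℤ) ^ 3 - N * p.1) =
      ∑ p ∈ N.divisorsAntidiagonal, (p.1 : ℤ) ^ 2 * (p.1 - 1) -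
      ∑ p ∈ N.divisorsAntidiagonal, (p.1 : ℤ) ^ 2 * (p.2 - 1) := by
    rw [← sum_sub_distrib]
    refine sum_congr rfl fun p hp => ?_
    rw [← (Nat.mem_divisorsAntidiagonal.1 hp).1]
    push_cast; ring
  linarith

theorem sum_Ico_odd_sq {z : ℕ} (hz : z % 2 = 1) :
    6 * ∑ x ∈ Ico 1 z, (if x % 2 = 1 then (x : ℤ) ^ 2 else 0) = z * (z - 1) * (z - 2) := by
  obtain ⟨k, rfl⟩ : ∃ k, z = 2 * k + 1 := ⟨z / 2, by omega⟩
  induction k with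
  | zero => simp
  | succ k ih =>
    rw [show 2 * (k + 1) + 1 = 2 * k + 1 + 1 + 1 by ring, sum_Ico_succ_top (by omega),
      sum_Ico_succ_top (by omega), mul_add, mul_add, ih (by omega), if_pos (by omega),
      if_neg (by omega)]
    push_cast; ring

theorem quadSum_mul_even_even {N : ℕ} (hN : N % 2 = 1) :
    24 * quadSum N (fun a b _ y => if b % 2 = 0 ∧ y % 2 = 0 then (a * b : ℤ) else 0) =
      ∑ p ∈ N.divisorsAntidiagonal, ((p.1 : ℤ) ^ 3 + 2 * p.1 - 3 * N * p.1) := by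
  have h := liouville_even hN (fun z => z ^ 2) (fun z => by ring)
  have h1 := quadSum_diag_even hN (fun z => z ^ 2)
  have h2 := quadSum_codiag hN (fun a _ => (a : ℤ) ^ 2)
  have h3 : 6 * quadSum N (fun a b x y => if x = y ∧ b % 2 = 0 then (a : ℤ) ^ 2 else 0) =
      ∑ p ∈ N.divisorsAntidiagonal, (p.1 : ℤ) * (p.1 - 1) * (p.1 - 2) := by
    rw [h2, mul_sum]
    refine sum_congr rfl fun p hp => sum_Ico_odd_sq ?_
    exact odd_of_mul_eq hN ((mul_comm _ _).trans (Nat.mem_divisorsAntidiagonal.1 hp).1)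
  have h4 : quadSum N (fun a b _ y => if b % 2 = 0 ∧ y % 2 = 0 then
      ((a : ℤ) + b) ^ 2 - (a - b) ^ 2 else 0) =
      4 * quadSum N (fun a b _ y => if b % 2 = 0 ∧ y % 2 = 0 then (a * b : ℤ) else 0) := by
    rw [← quadSum_mul]
    refine quadSum_congr fun a b x y _ _ _ _ _ => ?_
    split_ifs <;> ring
  have h5 : ∑ p ∈ N.divisorsAntidiagonal, ((p.1 : ℤ) ^ 3 + 2 * p.1 - 3 * N * p.1) =
      ∑ p ∈ N.divisorsAntidiagonal, (p.1 : ℤ) * (p.1 - 1) * (p.1 - 2) -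
      3 * ∑ p ∈ N.divisorsAntidiagonal, (p.1 : ℤ) ^ 2 * (p.2 - 1) := by
    rw [mul_sum, ← sum_sub_distrib]
    refine sum_congr rfl fun p hp => ?_
    rw [← (Nat.mem_divisorsAntidiagonal.1 hp).1]
    push_cast; ring
  linarith

/-- Moving a factor 2 from b to y preserves by and halves ab. -/
theorem quadSum_four_dvd (N : ℕ) :
    quadSum N (fun a b _ _ => if b % 4 = 0 then (a * b : ℤ) else 0) =
      2 * quadSum N (fun a b _ y => if b % 2 = 0 ∧ y % 2 = 0 then (a * b : ℤ) else 0) := by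
  rw [← quadSum_mul]
  simp only [mul_ite, mul_zero]
  unfold quadSum
  rw [← sum_filter, ← sum_filter]
  refine sum_nbij' (fun q => (q.1, q.2.1 / 2, q.2.2.1, 2 * q.2.2.2))
    (fun q => (q.1, 2 * q.2.1, q.2.2.1, q.2.2.2 / 2)) ?_ ?_ ?_ ?_ ?_
  · rintro ⟨a, b, x, y⟩
    simp only [mem_filter, mem_quads]
    rintro ⟨⟨h1, h2, h3, h4, h5⟩, h⟩
    obtain ⟨t, rfl⟩ := Nat.dvd_of_mod_eq_zero h
    rw [show 4 * t / 2 = 2 * t by omega]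
    exact ⟨⟨h1, by omega, h3, by omega, by rw [← h5]; ring⟩, by omega, by omega⟩
  · rintro ⟨a, b, x, y⟩
    simp only [mem_filter, mem_quads]
    rintro ⟨⟨h1, h2, h3, h4, h5⟩, hb, hy⟩
    obtain ⟨t, rfl⟩ := Nat.dvd_of_mod_eq_zero hy
    rw [show 2 * t / 2 = t by omega]
    exact ⟨⟨h1, by omega, h3, by omega, by rw [← h5]; ring⟩, by omega⟩
  · rintro ⟨a, b, x, y⟩
    simp only [mem_filter, Prod.mk.injEq]
    rintro ⟨-, h⟩
    exact ⟨trivial, by omega, trivial, by omega⟩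
  · rintro ⟨a, b, x, y⟩
    simp only [mem_filter, Prod.mk.injEq]
    rintro ⟨-, h⟩
    exact ⟨trivial, by omega, trivial, by omega⟩
  · rintro ⟨a, b, x, y⟩
    simp only [mem_filter]
    rintro ⟨-, h⟩
    obtain ⟨t, rfl⟩ := Nat.dvd_of_mod_eq_zero h
    rw [show 4 * t / 2 = 2 * t by omega]
    push_cast; ring

/-- `altSigma j = ∑_{d ∣ j} (-1) ^ (d - 1) d`. -/
def altSigma (j : ℕ) : ℤ :=
  ∑ p ∈ j.divisorsAntidiagonal, -((-1) ^ p.1 * (p.1 : ℤ))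

theorem neg_one_pow_half {b : ℕ} (hb : b % 2 = 0) :
    (-1 : ℤ) ^ (b / 2) = if b % 4 = 0 then 1 else -1 := by
  split_ifs with h
  · exact Even.neg_one_pow (by rw [Nat.even_iff]; omega)
  · exact Odd.neg_one_pow (by rw [Nat.odd_iff]; omega)

theorem sigma_recurrence (n : ℕ) :
    (n : ℤ) * ∑ p ∈ (2 * n + 1).divisorsAntidiagonal, (p.1 : ℤ) =
      4 * ∑ s ∈ antidiagonal n, altSigma s.1 *
        ∑ p ∈ (2 * s.2 + 1).divisorsAntidiagonal, (p.1 : ℤ) := by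
  have hN : (2 * n + 1) % 2 = 1 := by omega
  have h := quadSum_eq_convolution (k := 2) (u := 2) (v := 1) n two_pos one_pos rfl one_pos
    one_lt_two (fun a => (a : ℤ)) (fun d => -((-1) ^ d * (d : ℤ)))
  simp only [altSigma]
  rw [← h]
  -- For even b the sign -(-1)^(b/2) is 1 - 2[4 ∣ b]. With `quadSum_four_dvd` the right side becomes
  -- (even, odd) - 3·(even, even), and in this combination the cubic divisor sums cancel.
  have e : 2 * quadSum (2 * n + 1) (fun a b _ y => if 2 ∣ b ∧ 1 ∣ y then
      (a : ℤ) * -((-1) ^ (b / 2) * ((b / 2 : ℕ) : ℤ)) else 0) =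
      quadSum (2 * n + 1) (fun a b _ y => if b % 2 = 0 ∧ y % 2 = 1 then (a * b : ℤ) else 0) +
      quadSum (2 * n + 1) (fun a b _ y => if b % 2 = 0 ∧ y % 2 = 0 then (a * b : ℤ) else 0) -
      2 * quadSum (2 * n + 1) (fun a b x y => if b % 4 = 0 then (a * b : ℤ) else 0) := by
    rw [← quadSum_mul, ← quadSum_mul, ← quadSum_add, ← quadSum_sub]
    refine quadSum_congr fun a b x y _ _ _ _ _ => ?_
    by_cases hb : b % 2 = 0
    · rw [if_pos ⟨Nat.dvd_of_mod_eq_zero hb, one_dvd _⟩, neg_one_pow_half hb]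
      obtain ⟨t, rfl⟩ := Nat.dvd_of_mod_eq_zero hb
      rw [show 2 * t / 2 = t by omega]
      rcases Nat.mod_two_eq_zero_or_one y with hy | hy <;> simp [hy] <;> split_ifs <;> ring
    · have : ¬ b % 4 = 0 := by omega
      simp [hb, this, Nat.dvd_iff_mod_eq_zero]
  rw [quadSum_four_dvd] at e
  have h1 := quadSum_mul_even_odd hN
  have h2 := quadSum_mul_even_even hN
  rw [sum_sub_distrib, ← mul_sum] at h1
  rw [sum_sub_distrib, sum_add_distrib, ← mul_sum, ← mul_sum] at h2
  push_cast at h1 h2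
  linarith

/-! ### The recurrence for σ_{2,χ}(4n+3). -/

/-- The nontrivial character modulo `4` on the integers. -/
def chi (z : ℤ) : ℤ := ZMod.χ₄ (z : ZMod 4)

theorem chi_eq (z : ℤ) : chi z = if z % 2 = 0 then 0 else if z % 4 = 1 then 1 else -1 :=
  ZMod.χ₄_int_eq_if_mod_four z

theorem sum_Ico_odd_chi {z : ℕ} (hz : z % 2 = 1) :
    2 * ∑ x ∈ Ico 1 z, (if x % 2 = 1 then (x : ℤ) ^ 3 * chi x else 0) =
      - (chi z * ((z : ℤ) ^ 3 - 3 * z ^ 2 + 2)) := by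
  obtain ⟨k, rfl⟩ : ∃ k, z = 2 * k + 1 := ⟨z / 2, by omega⟩
  induction k with
  | zero => simp
  | succ k ih =>
    rw [show 2 * (k + 1) + 1 = 2 * k + 1 + 1 + 1 by ring, sum_Ico_succ_top (by omega),
      sum_Ico_succ_top (by omega), mul_add, mul_add, ih (by omega), if_pos (by omega),
      if_neg (by omega)]
    have : chi ((2 * k + 1 + 1 + 1 : ℕ) : ℤ) = - chi ((2 * k + 1 : ℕ) : ℤ) := by
      rw [chi_eq, chi_eq]
      grind
    rw [this]
    push_cast; ring

theorem chi_mul (a b : ℤ) : chi (a * b) = chi a * chi b := by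
  rw [chi, Int.cast_mul, map_mul]
  rfl

theorem chi_of_mul {N a x : ℕ} (hN : N % 4 = 3) (h : a * x = N) : chi x = - chi a := by
  have h1 : chi a * chi x = -1 := by
    rw [← chi_mul, chi_eq, ← Nat.cast_mul, h]
    grind
  have h2 := chi_eq a
  have h3 := chi_eq x
  grind

/-- Complementary divisors of N ≡ 3 mod 4 have opposite characters, so the sum equals its own
negative. -/
theorem sum_chi_eq_zero {N : ℕ} (hN : N % 4 = 3) :
    ∑ p ∈ N.divisorsAntidiagonal, chi p.1 = 0 := by
  have h := sum_divisorsAntidiagonal_comm N fun p => chi p.1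
  have h2 : ∑ p ∈ N.divisorsAntidiagonal, chi p.swap.1 =
      ∑ p ∈ N.divisorsAntidiagonal, - chi p.1 :=
    sum_congr rfl fun p hp => chi_of_mul hN (Nat.mem_divisorsAntidiagonal.1 hp).1
  rw [h2, sum_neg_distrib] at h
  linarith

/-- When b and y are even, ax ≡ N ≡ 3 mod 4, so exchanging a and x flips the sign of `chi a`. -/
theorem quadSum_chi_cube_eq_zero {N : ℕ} (hN : N % 4 = 3) :
    quadSum N (fun a b _ y => if b % 2 = 0 ∧ y % 2 = 0 then
      chi a * ((-1) ^ (b / 2) * (b : ℤ) ^ 3) else 0) = 0 := by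
  have h : quadSum N (fun a b _ y => if b % 2 = 0 ∧ y % 2 = 0 then
      chi a * ((-1) ^ (b / 2) * (b : ℤ) ^ 3) else 0) = (-1) * quadSum N (fun a b _ y =>
      if b % 2 = 0 ∧ y % 2 = 0 then chi a * ((-1) ^ (b / 2) * (b : ℤ) ^ 3) else 0) := by
    conv_lhs => rw [quadSum_swap_left]
    rw [← quadSum_mul]
    refine quadSum_congr fun a b x y _ _ _ _ h => ?_
    split_ifs with hby
    · obtain ⟨⟨s, rfl⟩, t, rfl⟩ := hby.imp Nat.dvd_of_mod_eq_zero Nat.dvd_of_mod_eq_zero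
      have hax : a * x % 4 = 3 := by
        have : a * x + 4 * (s * t) = N := by rw [← h]; ring
        omega
      rw [chi_of_mul hax rfl]
      ring
    · simp
  linarith

theorem quadSum_chi_sq {N : ℕ} (hN : N % 4 = 3) :
    12 * quadSum N (fun a b _ y => if b % 2 = 0 ∧ y % 2 = 0 then
      (chi a * a ^ 2) * ((-1) ^ (b / 2) * (b : ℤ)) else 0) =
      (3 - N) * ∑ p ∈ N.divisorsAntidiagonal, chi p.1 * (p.1 : ℤ) ^ 2 := by
  have hN2 : N % 2 = 1 := by omega
  -- z³χ(z) is even, being a product of two odd functions. For even b, χ(a ± b) = (-1)^(b/2) χ(a),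
  -- so the difference is (-1)^(b/2) χ(a)(6a²b + 2b³), whose b³ part sums to zero.
  have h := liouville_even hN2 (fun z => z ^ 3 * chi z) (fun z => by
    have : chi (-z) = - chi z := by rw [chi_eq, chi_eq]; grind
    rw [this]; ring)
  have h1 := quadSum_diag_even hN2 (fun z => z ^ 3 * chi z)
  have h2 := quadSum_codiag hN2 (fun a _ => (a : ℤ) ^ 3 * chi a)
  have h3 : 2 * quadSum N (fun a b x y => if x = y ∧ b % 2 = 0 then
      (a : ℤ) ^ 3 * chi a else 0) =
      ∑ p ∈ N.divisorsAntidiagonal, -(chi p.1 * ((p.1 : ℤ) ^ 3 - 3 * p.1 ^ 2 + 2)) := by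
    rw [h2, mul_sum]
    refine sum_congr rfl fun p hp => sum_Ico_odd_chi ?_
    exact odd_of_mul_eq hN2 ((mul_comm _ _).trans (Nat.mem_divisorsAntidiagonal.1 hp).1)
  have h4 : quadSum N (fun a b _ y => if b % 2 = 0 ∧ y % 2 = 0 then
      ((a : ℤ) + b) ^ 3 * chi (a + b) - (a - b) ^ 3 * chi (a - b) else 0) =
      6 * quadSum N (fun a b _ y => if b % 2 = 0 ∧ y % 2 = 0 then
        (chi a * a ^ 2) * ((-1) ^ (b / 2) * (b : ℤ)) else 0) +
      2 * quadSum N (fun a b _ y => if b % 2 = 0 ∧ y % 2 = 0 then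
        chi a * ((-1) ^ (b / 2) * (b : ℤ) ^ 3) else 0) := by
    rw [← quadSum_mul, ← quadSum_mul, ← quadSum_add]
    refine quadSum_congr fun a b x y _ _ _ _ _ => ?_
    split_ifs with hby
    · have e1 : chi ((a : ℤ) + b) = (-1) ^ (b / 2) * chi a := by
        rw [neg_one_pow_half hby.1, chi_eq, chi_eq]; grind
      have e2 : chi ((a : ℤ) - b) = (-1) ^ (b / 2) * chi a := by
        rw [neg_one_pow_half hby.1, chi_eq, chi_eq]; grind
      rw [e1, e2]; ring
    · simp
  rw [quadSum_chi_cube_eq_zero hN] at h4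
  have h5 : ∑ p ∈ N.divisorsAntidiagonal, -(chi p.1 * ((p.1 : ℤ) ^ 3 - 3 * p.1 ^ 2 + 2)) -
      ∑ p ∈ N.divisorsAntidiagonal, (p.1 : ℤ) ^ 3 * chi p.1 * (p.2 - 1) =
      (3 - N) * ∑ p ∈ N.divisorsAntidiagonal, chi p.1 * (p.1 : ℤ) ^ 2 -
      2 * ∑ p ∈ N.divisorsAntidiagonal, chi p.1 := by
    rw [mul_sum, mul_sum, ← sum_sub_distrib, ← sum_sub_distrib]
    refine sum_congr rfl fun p hp => ?_
    rw [← (Nat.mem_divisorsAntidiagonal.1 hp).1]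
    push_cast; ring
  rw [sum_chi_eq_zero hN] at h5
  linarith

theorem sigmaChar_recurrence (n : ℕ) :
    (n : ℤ) * ∑ p ∈ (4 * n + 3).divisorsAntidiagonal, chi p.1 * (p.1 : ℤ) ^ 2 =
      6 * ∑ s ∈ antidiagonal n, altSigma s.1 *
        ∑ p ∈ (4 * s.2 + 3).divisorsAntidiagonal, chi p.1 * (p.1 : ℤ) ^ 2 := by
  have h := quadSum_eq_convolution (k := 4) (u := 2) (v := 2) n two_pos two_pos rfl three_pos
    (by norm_num) (fun a => chi a * (a : ℤ) ^ 2) (fun d => -((-1) ^ d * (d : ℤ)))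
  simp only [altSigma]
  rw [← h]
  have e : (-2) * quadSum (4 * n + 3) (fun a b _ y => if 2 ∣ b ∧ 2 ∣ y then
      chi a * (a : ℤ) ^ 2 * -((-1) ^ (b / 2) * ((b / 2 : ℕ) : ℤ)) else 0) =
      quadSum (4 * n + 3) (fun a b _ y => if b % 2 = 0 ∧ y % 2 = 0 then
        (chi a * a ^ 2) * ((-1) ^ (b / 2) * (b : ℤ)) else 0) := by
    rw [← quadSum_mul]
    refine quadSum_congr fun a b x y _ _ _ _ _ => ?_
    simp only [← Nat.dvd_iff_mod_eq_zero]
    split_ifs with hby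
    · obtain ⟨t, rfl⟩ := hby.1
      rw [show 2 * t / 2 = t by omega]
      push_cast; ring
    · simp
  have h1 := quadSum_chi_sq (N := 4 * n + 3) (by omega)
  push_cast at h1
  linarith

/-! ### Generating functions and reduction modulo p. -/

section PodSeries
open PowerSeries
open scoped PowerSeries.WithPiTopology

/-- The generating function of the numbers `pod ℓ n`. -/
noncomputable def podSeries (R : Type*) [CommRing R] (ℓ : ℕ) : R⟦X⟧ :=
  PowerSeries.mk fun n => (pod ℓ n : R)

/-- The contribution of the parts equal to `i` to the generating function of partitions with
distinct odd parts. -/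
noncomputable def podFactor (R : Type*) [CommRing R] (i : ℕ) : R⟦X⟧ :=
  if Odd i then 1 + X ^ i else invOfUnit (1 - X ^ i) 1

theorem podFactor_odd (R : Type*) [CommRing R] {i : ℕ} (hi : Odd i) :
    podFactor R i = 1 + X ^ i := if_pos hi

theorem one_sub_mul_podFactor_even (R : Type*) [CommRing R] {i : ℕ} (hi : ¬ Odd i) (h0 : i ≠ 0) :
    (1 - X ^ i) * podFactor R i = 1 := by
  rw [podFactor, if_neg hi]
  exact mul_invOfUnit _ _ (by simp [h0])

theorem hasProd_podSeries (R : Type*) [CommRing R] [TopologicalSpace R] [IsTopologicalRing R]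
    [T2Space R] (ℓ : ℕ) :
    HasProd (fun i => if ℓ ∣ i + 1 then 1 else podFactor R (i + 1)) (podSeries R ℓ) := by
  convert! Nat.Partition.hasProd_genFun (fun i c => if ¬ ℓ ∣ i ∧ (Odd i → c = 1) then (1 : R) else 0)
    using 1
  · ext1 i
    by_cases hl : ℓ ∣ i + 1
    · simp [hl]
    · by_cases hi : Odd (i + 1)
      · rw [if_neg hl, podFactor_odd R hi, tsum_eq_single 0]
        · simp [hl]
        · intro b hb
          simp [hl, hi, hb]
      · rw [if_neg hl]
        -- An even part may have any multiplicity, so its factor is a geometric series.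
        have h1 : (1 : R⟦X⟧) + ∑' j, (if ¬ ℓ ∣ i + 1 ∧ (Odd (i + 1) → j + 1 = 1) then (1 : R) else 0) •
            (X : R⟦X⟧) ^ ((i + 1) * (j + 1)) = ∑' j : ℕ, ((X : R⟦X⟧) ^ (i + 1)) ^ j := by
          rw [tsum_eq_zero_add' (f := fun j : ℕ => ((X : R⟦X⟧) ^ (i + 1)) ^ j) ?_]
          · simp [hl, hi, pow_mul]
          · simp_rw [pow_succ]
            apply Summable.mul_right
            exact WithPiTopology.summable_pow_of_constantCoeff_eq_zero (by simp)
        rw [h1]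
        have h2 := WithPiTopology.tsum_pow_mul_one_sub_of_constantCoeff_eq_zero (R := R)
          (f := X ^ (i + 1)) (by simp)
        have h3 := one_sub_mul_podFactor_even R hi (Nat.succ_ne_zero i)
        calc podFactor R (i + 1) = (∑' j : ℕ, ((X : R⟦X⟧) ^ (i + 1)) ^ j) * (1 - X ^ (i + 1)) *
              podFactor R (i + 1) := by rw [h2, one_mul]
          _ = _ := by rw [mul_assoc, h3, mul_one]
  · ext n
    rw [podSeries, coeff_mk, Nat.Partition.coeff_genFun, pod, podPartitions, card_filter]
    push_cast
    refine sum_congr rfl fun p _ => ?_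
    rw [Finsupp.prod, prod_boole]
    refine if_congr ?_ rfl rfl
    simp only [Multiset.toFinsupp_support, Multiset.mem_toFinset, Multiset.toFinsupp_apply]
    grind

theorem pod_zero_right (ℓ : ℕ) : pod ℓ 0 = 1 := by
  rw [pod, podPartitions, filter_true_of_mem]
  · simp
  · intro p _
    simp

theorem constantCoeff_podSeries (R : Type*) [CommRing R] (ℓ : ℕ) :
    constantCoeff (podSeries R ℓ) = 1 := by
  rw [podSeries, ← coeff_zero_eq_constantCoeff_apply, coeff_mk, pod_zero_right, Nat.cast_one]

theorem isUnit_podSeries (R : Type*) [CommRing R] (ℓ : ℕ) : IsUnit (podSeries R ℓ) := by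
  rw [isUnit_iff_constantCoeff, constantCoeff_podSeries]
  exact isUnit_one

/-- Frobenius gives (1 ± q^i)^p = 1 ± q^(pi); p odd is needed for i and pi to have the same parity.
-/
theorem podFactor_mul_of_prime (R : Type*) [CommRing R] {p : ℕ} [Fact p.Prime] [CharP R p]
    (hp : Odd p) {i : ℕ} (hi : i ≠ 0) : podFactor R (p * i) = podFactor R i ^ p := by
  have : CharP R⟦X⟧ p := charP_of_injective_ringHom (C_injective (R := R)) p
  by_cases h : Odd i
  · rw [podFactor_odd R h, podFactor_odd R (hp.mul h), add_pow_char, one_pow, ← pow_mul, mul_comm]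
  · have h' : ¬ Odd (p * i) := fun h' => h (Nat.Odd.of_mul_right h')
    have h1 := one_sub_mul_podFactor_even R h hi
    have h2 := one_sub_mul_podFactor_even R h' (mul_ne_zero (Fact.out (p := p.Prime)).ne_zero hi)
    have h3 : (1 - (X : R⟦X⟧) ^ (p * i)) * podFactor R i ^ p = 1 := by
      rw [mul_comm p, pow_mul, ← one_pow (M := R⟦X⟧) p, ← sub_pow_char, one_pow, ← mul_pow, h1,
        one_pow]
    calc podFactor R (p * i) = podFactor R (p * i) * ((1 - X ^ (p * i)) * podFactor R i ^ p) := by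
          rw [h3, mul_one]
      _ = (1 - X ^ (p * i)) * podFactor R (p * i) * podFactor R i ^ p := by ring
      _ = _ := by rw [h2, one_mul]

/-- Restoring the factors at multiples of p, whose product is P^p, turns the p-regular product into
P; the unit P then cancels once. -/
theorem podSeries_mul_pow (R : Type*) [CommRing R] {p : ℕ} [hpp : Fact p.Prime] [CharP R p]
    (hp : Odd p) : podSeries R p * podSeries R 0 ^ (p - 1) = 1 := by
  let _ : TopologicalSpace R := ⊥
  have : DiscreteTopology R := ⟨rfl⟩
  have h0 : HasProd (fun i => podFactor R (i + 1)) (podSeries R 0) := by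
    simpa using hasProd_podSeries R 0
  have h1 : HasProd (fun i => if p ∣ i + 1 then podFactor R (i + 1) else 1)
      (podSeries R 0 ^ p) := by
    -- Index i stands for the part i + 1, so the part p(i + 1) sits at index p(i + 1) - 1.
    have hinj : Function.Injective fun i => p * (i + 1) - 1 := by
      intro i j hij
      have hi : 0 < p * (i + 1) := Nat.mul_pos hpp.out.pos i.succ_pos
      have hj : 0 < p * (j + 1) := Nat.mul_pos hpp.out.pos j.succ_pos
      have : p * (i + 1) = p * (j + 1) := by simp only at hij; omega
      simpa using Nat.eq_of_mul_eq_mul_left hpp.out.pos this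
    rw [← hinj.hasProd_iff]
    · convert! h0.pow p using 1
      ext1 i
      have hi := Nat.mul_pos hpp.out.pos i.succ_pos
      rw [Function.comp_apply, Nat.sub_add_cancel hi, if_pos (dvd_mul_right _ _),
        podFactor_mul_of_prime R hp i.succ_ne_zero]
    · intro i hi
      rw [if_neg]
      rintro ⟨j, hj⟩
      refine hi ⟨j - 1, ?_⟩
      have : j ≠ 0 := by rintro rfl; simp at hj
      simp only
      rw [Nat.sub_add_cancel (Nat.pos_of_ne_zero this), ← hj, Nat.add_sub_cancel]
  have h2 := (hasProd_podSeries R p).mul h1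
  have h3 : podSeries R p * podSeries R 0 ^ p = podSeries R 0 := by
    refine h2.unique ?_
    convert! h0 using 1
    ext1 i
    split_ifs <;> simp
  refine (isUnit_podSeries R 0).mul_left_injective ?_
  simp only
  rw [mul_assoc, ← pow_succ, Nat.sub_add_cancel hpp.out.pos, h3, one_mul]

/-! ### Logarithmic derivative of the product. -/

/-- The logarithmic derivative `X * u' / u` of `u = podFactor ℤ i`. -/
noncomputable def podLog (i : ℕ) : ℤ⟦X⟧ :=
  PowerSeries.mk fun j => if j ≠ 0 ∧ i ∣ j then (-1) ^ (i + j) * (i : ℤ) else 0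

/-- The geometric expansion of i q^i / (1 - (-1)^i q^i), with the denominator cleared; this covers
both parities of i. -/
theorem podLog_mul {i : ℕ} (hi : i ≠ 0) :
    podLog i * (1 - (-1) ^ i * X ^ i) = (i : ℤ⟦X⟧) * X ^ i := by
  ext j
  have e : podLog i * (1 - (-1) ^ i * X ^ i) = podLog i - C ((-1) ^ i) * (podLog i * X ^ i) := by
    simp only [map_pow, map_neg, map_one]; ring
  rw [e, map_sub, coeff_C_mul, coeff_mul_X_pow', ← map_natCast (C (R := ℤ)), coeff_C_mul,
    coeff_X_pow]
  simp only [podLog, coeff_mk]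
  by_cases hij : i ≤ j
  · obtain ⟨t, rfl⟩ := Nat.exists_eq_add_of_le hij
    have h1 : i ∣ i + t ↔ i ∣ t := by simp
    have h2 : (-1 : ℤ) ^ (i + (i + t)) = (-1) ^ t := by
      rw [← add_assoc, pow_add, Even.neg_one_pow ⟨i, rfl⟩, one_mul]
    have h3 : (-1 : ℤ) ^ i * ((-1) ^ (i + t) * (i : ℤ)) = (-1) ^ t * i := by
      rw [← mul_assoc, ← pow_add, h2]
    simp only [hij, if_true, Nat.add_sub_cancel_left, h1, h2, mul_ite, h3, mul_zero]
    rcases Nat.eq_zero_or_pos t with rfl | ht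
    · simp [hi]
    · simp [ht.ne']
  · have : ¬ (j ≠ 0 ∧ i ∣ j) := fun h => hij (Nat.le_of_dvd (Nat.pos_of_ne_zero h.1) h.2)
    have h' : j ≠ i := by omega
    simp [this, hij, h']

theorem X_mul_derivative_X_pow {i : ℕ} (hi : i ≠ 0) :
    X * d⁄dX ℤ ((X : ℤ⟦X⟧) ^ i) = (i : ℤ⟦X⟧) * X ^ i := by
  rw [Derivation.leibniz_pow, derivative_X]
  obtain ⟨k, rfl⟩ := Nat.exists_eq_succ_of_ne_zero hi
  simp only [Nat.succ_eq_add_one, Nat.add_sub_cancel, nsmul_eq_mul, smul_eq_mul]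
  ring

theorem X_mul_derivative_podFactor {i : ℕ} (hi : i ≠ 0) :
    X * d⁄dX ℤ (podFactor ℤ i) = podFactor ℤ i * podLog i := by
  have h := podLog_mul hi
  by_cases ho : Odd i
  · rw [podFactor_odd ℤ ho, map_add, derivative_one, zero_add, X_mul_derivative_X_pow hi, ← h,
      ho.neg_one_pow]
    ring
  · have h1 := one_sub_mul_podFactor_even ℤ ho hi
    have h2 := congrArg (fun f => X * d⁄dX ℤ f) h1
    simp only [Derivation.leibniz, map_sub, derivative_one, smul_eq_mul, mul_zero, zero_sub] at h2
    have h3 := X_mul_derivative_X_pow hi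
    rw [(Nat.not_odd_iff_even.1 ho).neg_one_pow, one_mul] at h
    have h4 : (1 - (X : ℤ⟦X⟧) ^ i) * (X * d⁄dX ℤ (podFactor ℤ i)) =
        (1 - X ^ i) * (podFactor ℤ i * podLog i) := by
      linear_combination h2 + podFactor ℤ i * h3 - podFactor ℤ i * h
    exact mul_left_cancel₀ (left_ne_zero_of_mul_eq_one h1) h4

theorem X_mul_derivative_prod (s : Finset ℕ) :
    X * d⁄dX ℤ (∏ i ∈ s, podFactor ℤ (i + 1)) =
      (∏ i ∈ s, podFactor ℤ (i + 1)) * ∑ i ∈ s, podLog (i + 1) := by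
  induction s using Finset.induction_on with
  | empty => simp
  | insert a s ha ih =>
    have h := X_mul_derivative_podFactor (Nat.succ_ne_zero a)
    rw [prod_insert ha, sum_insert ha, Derivation.leibniz, smul_eq_mul, smul_eq_mul]
    linear_combination podFactor ℤ (a + 1) * ih + (∏ i ∈ s, podFactor ℤ (i + 1)) * h

theorem coeff_sum_podLog {s : Finset ℕ} {j n : ℕ} (hj : j ≤ n) (hs : range n ⊆ s) :
    coeff j (∑ i ∈ s, podLog (i + 1)) = -((-1) ^ j * altSigma j) := by
  rw [map_sum]
  simp only [podLog, coeff_mk]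
  rcases Nat.eq_zero_or_pos j with rfl | h0
  · simp [altSigma]
  · rw [altSigma, Nat.sum_divisorsAntidiagonal (f := fun d _ => -((-1) ^ d * (d : ℤ))), mul_sum,
      ← sum_neg_distrib, ← sum_filter]
    refine sum_nbij' (fun i => i + 1) (fun d => d - 1) ?_ ?_ ?_ ?_ ?_
    · intro i
      simp only [mem_filter, Nat.mem_divisors]
      rintro ⟨-, h1, h2⟩
      exact ⟨h2, h1⟩
    · intro d
      simp only [mem_filter, Nat.mem_divisors]
      rintro ⟨h1, h2⟩
      have := Nat.le_of_dvd h0 h1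
      have := Nat.pos_of_dvd_of_pos h1 h0
      rw [Nat.sub_add_cancel this]
      exact ⟨hs (mem_range.2 (by omega)), h2, h1⟩
    · intro i _
      rfl
    · intro d
      simp only [Nat.mem_divisors]
      rintro ⟨h1, h2⟩
      exact Nat.sub_add_cancel (Nat.pos_of_dvd_of_pos h1 h0)
    · intro i _
      ring

theorem X_mul_derivative_podSeries :
    X * d⁄dX ℤ (podSeries ℤ 0) =
      podSeries ℤ 0 * PowerSeries.mk fun j => -((-1) ^ j * altSigma j) := by
  have h0 : HasProd (fun i => podFactor ℤ (i + 1)) (podSeries ℤ 0) := by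
    simpa using hasProd_podSeries ℤ 0
  rw [HasProd, WithPiTopology.tendsto_iff_coeff_tendsto] at h0
  ext n
  -- The infinite product need not be differentiated: for each n, some finite product has the right
  -- coefficients up to degree n and contains every part of size at most n.
  have h1 : ∀ᶠ s : Finset ℕ in Filter.atTop, ∀ k ∈ range (n + 1),
      coeff k (∏ i ∈ s, podFactor ℤ (i + 1)) = coeff k (podSeries ℤ 0) := by
    rw [Filter.eventually_all_finset]
    intro k _
    have := h0 k
    rw [nhds_discrete, Filter.tendsto_pure] at this
    simpa using this
  obtain ⟨s, h2, h3⟩ := (h1.and (Filter.eventually_ge_atTop (range n))).exists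
  have h4 := congrArg (coeff n) (X_mul_derivative_prod s)
  have h5 : ∀ f : ℤ⟦X⟧, coeff n (X * d⁄dX ℤ f) = n * coeff n f := by
    intro f
    cases n with
    | zero => simp
    | succ n => rw [coeff_succ_X_mul, coeff_derivative]; push_cast; ring
  rw [h5, h2 n (by simp), coeff_mul] at h4
  rw [h5, h4, coeff_mul]
  refine sum_congr rfl fun p hp => ?_
  have hp' := HasAntidiagonal.mem_antidiagonal.1 hp
  rw [h2 p.1 (mem_range.2 (by omega)), coeff_sum_podLog (by omega : p.2 ≤ n) h3, coeff_mk]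

/-- A sequence with the same recurrence as the coefficients of the `k`-th power of the inverse of
the generating function is, up to a factor and alternating signs, that sequence. -/
theorem mk_mul_podSeries_pow (a : ℕ → ℤ) (k : ℕ)
    (h : ∀ n : ℕ, (n : ℤ) * a n = k * ∑ s ∈ antidiagonal n, altSigma s.1 * a s.2) :
    (PowerSeries.mk fun n => (-1) ^ n * a n) * podSeries ℤ 0 ^ k = C (a 0) := by
  set A : ℤ⟦X⟧ := PowerSeries.mk fun n => (-1) ^ n * a n with hA
  set D : ℤ⟦X⟧ := PowerSeries.mk fun j => -((-1) ^ j * altSigma j) with hD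
  have hA' : X * d⁄dX ℤ A = - ((k : ℤ⟦X⟧) * (D * A)) := by
    ext n
    have h5 : coeff n (X * d⁄dX ℤ A) = n * coeff n A := by
      cases n with
      | zero => simp
      | succ n => rw [coeff_succ_X_mul, coeff_derivative]; push_cast; ring
    rw [h5, map_neg, ← map_natCast (C (R := ℤ)), coeff_C_mul, coeff_mul, hA, hD]
    simp only [coeff_mk]
    rw [mul_left_comm, h, mul_left_comm, mul_sum, ← mul_neg, ← sum_neg_distrib]
    congr 1
    refine sum_congr rfl fun p hp => ?_
    rw [← HasAntidiagonal.mem_antidiagonal.1 hp, pow_add]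
    ring
  -- Over ℤ, a zero derivative forces a constant series; this fails in characteristic p, so
  -- reduction modulo p comes only afterwards.
  refine derivative.ext ?_ ?_
  · rw [derivative_C]
    have hX : (X : ℤ⟦X⟧) * d⁄dX ℤ (A * podSeries ℤ 0 ^ k) = 0 := by
      have hP := X_mul_derivative_podSeries
      rw [← hD] at hP
      rw [Derivation.leibniz, Derivation.leibniz_pow]
      simp only [smul_eq_mul, nsmul_eq_mul]
      rcases Nat.eq_zero_or_pos k with rfl | hk
      · simp only [Nat.cast_zero, zero_mul, neg_zero, mul_zero, pow_zero, one_mul, zero_add] at hA' ⊢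
        exact hA'
      · obtain ⟨m, rfl⟩ := Nat.exists_eq_add_of_le' hk
        rw [Nat.add_sub_cancel]
        linear_combination A * ((m + 1 : ℕ) : ℤ⟦X⟧) * podSeries ℤ 0 ^ m * hP +
          podSeries ℤ 0 ^ (m + 1) * hA'
    exact (mul_eq_zero.1 hX).resolve_left X_ne_zero
  · rw [map_mul, map_pow, constantCoeff_podSeries, constantCoeff_C,
      ← coeff_zero_eq_constantCoeff_apply, hA, coeff_mk]
    simp

end PodSeries

/-! ### The two power identities and the congruences. -/

theorem sigma_eq_sum_divisorsAntidiagonal (m : ℕ) :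
    ((ArithmeticFunction.sigma 1 m : ℕ) : ℤ) = ∑ p ∈ m.divisorsAntidiagonal, (p.1 : ℤ) := by
  rw [ArithmeticFunction.sigma_one_apply, Nat.sum_divisorsAntidiagonal (f := fun d _ => (d : ℤ))]
  push_cast
  rfl

theorem sigmaChar_eq_sum_divisorsAntidiagonal (m : ℕ) :
    sigmaChar 2 ZMod.χ₄ m = ∑ p ∈ m.divisorsAntidiagonal, chi p.1 * (p.1 : ℤ) ^ 2 := by
  rw [sigmaChar, Nat.sum_divisorsAntidiagonal (f := fun d _ => chi d * (d : ℤ) ^ 2)]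
  simp only [chi, Int.cast_natCast]

theorem sigmaChar_three : sigmaChar 2 ZMod.χ₄ 3 = -8 := by
  decide

theorem map_podSeries {R S : Type*} [CommRing R] [CommRing S] (f : R →+* S) (ℓ : ℕ) :
    PowerSeries.map f (podSeries R ℓ) = podSeries S ℓ := by
  ext n
  simp [podSeries]

theorem sigma_mul_podSeries :
    (PowerSeries.mk fun n => (-1) ^ n * ((ArithmeticFunction.sigma 1 (2 * n + 1) : ℕ) : ℤ)) *
      podSeries ℤ 0 ^ 4 = 1 := by
  simp only [sigma_eq_sum_divisorsAntidiagonal]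
  rw [mk_mul_podSeries_pow _ 4 sigma_recurrence]
  simp

theorem sigmaChar_mul_podSeries :
    (PowerSeries.mk fun n => (-1) ^ n * sigmaChar 2 ZMod.χ₄ (4 * n + 3)) *
      podSeries ℤ 0 ^ 6 = PowerSeries.C (-8) := by
  rw [mk_mul_podSeries_pow (fun n => sigmaChar 2 ZMod.χ₄ (4 * n + 3)) 6]
  · rw [mul_zero, zero_add, sigmaChar_three]
  · simp only [sigmaChar_eq_sum_divisorsAntidiagonal]
    exact sigmaChar_recurrence

/-- A power series inverse, up to a constant, to a power of the generating function is congruent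
to a multiple of the generating function for regular partitions. -/
theorem coeff_eq_of_mul_podSeries {p : ℕ} [Fact p.Prime] (hp : Odd p) {A : PowerSeries ℤ} {c : ℤ}
    (h : A * podSeries ℤ 0 ^ (p - 1) = PowerSeries.C c) (n : ℕ) :
    ((PowerSeries.coeff n A : ℤ) : ZMod p) = c * pod p n := by
  have h1 := congrArg (PowerSeries.map (Int.castRingHom (ZMod p))) h
  rw [map_mul, map_pow, map_podSeries, PowerSeries.map_C] at h1
  have h2 := podSeries_mul_pow (ZMod p) hp
  have h3 : PowerSeries.map (Int.castRingHom (ZMod p)) A =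
      PowerSeries.C (Int.castRingHom (ZMod p) c) * podSeries (ZMod p) p := by
    linear_combination podSeries (ZMod p) p * h1 -
      PowerSeries.map (Int.castRingHom (ZMod p)) A * h2
  have h4 := congrArg (PowerSeries.coeff n) h3
  rw [PowerSeries.coeff_map, PowerSeries.coeff_C_mul, podSeries, PowerSeries.coeff_mk] at h4
  simpa using h4

/-- P has constant term 1, hence is invertible over ℤ, and A is c times an integral series. -/
theorem dvd_coeff_of_mul_podSeries {k : ℕ} {A : PowerSeries ℤ} {c : ℤ}
    (h : A * podSeries ℤ 0 ^ k = PowerSeries.C c) (n : ℕ) : c ∣ PowerSeries.coeff n A := by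
  obtain ⟨u, hu⟩ := (isUnit_podSeries ℤ 0).pow k
  have : A = PowerSeries.C c * (↑u⁻¹ : PowerSeries ℤ) := by
    rw [← h, ← hu, mul_assoc, Units.mul_inv, mul_one]
  rw [this, PowerSeries.coeff_C_mul]
  exact dvd_mul_right _ _

theorem theorem3 (n : ℕ) (hn : 0 < n) :
    ((pod 5 n : ℤ) ≡ (-1) ^ n * (ArithmeticFunction.sigma 1 (2 * n + 1) : ℤ) [ZMOD 5]) ∧
    ((8 : ℤ) ∣ sigmaChar 2 ZMod.χ₄ (4 * n + 3)) ∧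
    ((pod 7 n : ℤ) ≡ (-1) ^ (n + 1) * (sigmaChar 2 ZMod.χ₄ (4 * n + 3) / 8) [ZMOD 7]) := by
  have : Fact (Nat.Prime 5) := ⟨by norm_num⟩
  have : Fact (Nat.Prime 7) := ⟨by norm_num⟩
  have h8 : (8 : ℤ) ∣ sigmaChar 2 ZMod.χ₄ (4 * n + 3) := by
    have := dvd_coeff_of_mul_podSeries sigmaChar_mul_podSeries n
    rw [PowerSeries.coeff_mk, neg_dvd] at this
    exact ((isUnit_one.neg.pow n).dvd_mul_left).1 this
  refine ⟨?_, h8, ?_⟩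
  · have h := coeff_eq_of_mul_podSeries (p := 5) (by decide) (c := 1)
      (by simpa using sigma_mul_podSeries) n
    rw [PowerSeries.coeff_mk, Int.cast_one, one_mul] at h
    refine (ZMod.intCast_eq_intCast_iff _ _ 5).1 ?_
    simpa using h.symm
  · obtain ⟨t, ht⟩ := h8
    have h := coeff_eq_of_mul_podSeries (p := 7) (by decide) sigmaChar_mul_podSeries n
    rw [PowerSeries.coeff_mk, ht] at h
    rw [ht, Int.mul_ediv_cancel_left _ (by norm_num)]
    refine (ZMod.intCast_eq_intCast_iff _ _ 7).1 ?_
    push_cast at h ⊢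
    have h7 : (7 : ZMod 7) = 0 := by exact_mod_cast CharP.cast_eq_zero (ZMod 7) 7
    rw [pow_succ]
    -- The factor 8 on both sides is 1 modulo 7.
    linear_combination h - (pod 7 n + (-1) ^ n * t) * h7
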